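/- Let $G$ be an $n$-dimensional Lie group with Lie algebra $\mathfrak g$ of left invariant vector fields, and let $TG$ be its tangent Lie group, with multiplication $T\mu(v,w)=T_hL_g w+T_gR_h v$ for $v\in T_gG$, $w\in T_hG$. For a vector field $X$ on $G$ with flow $\varphi_t$, let $X^v$ be its vertical lift (generated by the curves $t\mapsto y+tX(x)$, $y\in T_xG$) and $X^c$ its complete lift (generated by $T\varphi_t$). Let $g^1,g^2$ be left invariant Riemannian metrics on $G$, and let $\tilde g$ be the left invariant Riemannian metric on $TG$ with $$\tilde g(X^c,Y^c)=g^1(X,Y),\qquad \tilde g(X^v,Y^v)=g^2(X,Y),\qquad \tilde g(X^c,Y^v)=0\qquad (X,Y\in\mathfrak g).$$ Let $\varphi:\mathfrak g\to\mathfrak g$ be the linear map with $g^2(X,Y)=g^1(\varphi(X),Y)$ for all $X,Y\in\mathfrak g$, let $\{X_1,\dots,X_n\}$ be a $g^1$-orthonormal basis of $\mathfrak g$ with $\varphi(X_i)=\lambda_iX_i$, and let the structure constants $c_{ij}^k$ be defined by $[X_i,X_j]=\sum_{k=1}^n c_{ij}^kX_k$. Let $K^1$ and $\tilde K$ be the sectional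 curvatures of $(G,g^1)$ and $(TG,\tilde g)$, where, for the Levi-Civita connection $\nabla$ of a metric $g$, $R(X,Y)Z=\nabla_X\nabla_YZ-\nabla_Y\nabla_XZ-\nabla_{[X,Y]}Z$ and $K(X,Y)=\dfrac{g(R(X,Y)Y,X)}{g(X,X)g(Y,Y)-g(X,Y)^2}$. Then, at every point of $TG$: 1. for all $i\neq j$, $$\tilde K(X_i^c,X_j^c)=\frac14\sum_{l=1}^n\Big(-4c_{lj}^jc_{li}^i-(c_{ij}^l-c_{jl}^i+c_{li}^j)(c_{jl}^i-c_{li}^j+c_{ij}^l)-2c_{ij}^l(c_{lj}^i-c_{ji}^l+c_{il}^j)\Big)=K^1(X_i,X_j);$$ 2. for all $i\neq j$, $$\tilde K\Big(\frac{X_i^v}{\sqrt{\lambda_i}},\frac{X_j^v}{\sqrt{\lambda_j}}\Big)=\frac14\sum_{l=1}^n\Big(\Big(\frac{\sqrt{\lambda_j}}{\sqrt{\lambda_i}}c_{li}^j+\frac{\sqrt{\lambda_i}}{\sqrt{\lambda_j}}c_{lj}^i\Big)^2-4c_{lj}^jc_{li}^i\Big);$$ 3. for all $i,j$, $$\tilde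 K\Big(\frac{X_i^v}{\sqrt{\lambda_i}},X_j^c\Big)=\frac14\sum_{l=1}^n\Big(\frac{\lambda_i}{\lambda_l}(c_{jl}^i)^2-3\frac{\lambda_l}{\lambda_i}(c_{ij}^l)^2-2c_{ij}^lc_{lj}^i-4c_{lj}^jc_{li}^i\Big).$$ -/

import Mathlib

open Bundle
open scoped Manifold ContDiff

noncomputable section

section RiemannianGeometry

variable {E : Type*} [NormedAddCommGroup E] [NormedSpace ℝ E]
  {H : Type*} [TopologicalSpace H] {I : ModelWithCorners ℝ E H}
  {M : Type*} [TopologicalSpace M] [ChartedSpace H M] [IsManifold I ∞ M]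

variable (I M) in
/-- A smooth Riemannian metric on the manifold `M`. -/
abbrev SmoothRiemannianMetric : Type _ :=
  ContMDiffRiemannianMetric I ∞ E (fun x : M ↦ TangentSpace I x)

variable (I M) in
/-- An affine connection on `M`; `D Y x v` is the value `(∇_v Y)(x)`. -/
abbrev AffineConnection : Type _ :=
  CovariantDerivative I E (fun x : M ↦ TangentSpace I x)

/-- `D` is the Levi-Civita connection of `g`: it is metric and torsion free. -/
structure IsLeviCivita [FiniteDimensional ℝ E]
    (g : SmoothRiemannianMetric I M) (D : AffineConnection I M) : Prop where
  /-- `v (g(Y, Z)) = g(∇_v Y, Z) + g(Y, ∇_v Z)`. -/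
  metric : ∀ (Y Z : Π x : M, TangentSpace I x) (x : M) (v : TangentSpace I x),
    MDifferentiableAt I I.tangent (fun y ↦ (⟨y, Y y⟩ : TangentBundle I M)) x →
    MDifferentiableAt I I.tangent (fun y ↦ (⟨y, Z y⟩ : TangentBundle I M)) x →
    mvfderiv I (fun y ↦ g.inner y (Y y) (Z y)) x v
      = g.inner x (D Y x v) (Z x) + g.inner x (Y x) (D Z x v)
  /-- `∇_X Y - ∇_Y X = [X, Y]`. -/
  torsionFree : ∀ (X Y : Π x : M, TangentSpace I x) (x : M),
    MDifferentiableAt I I.tangent (fun y ↦ (⟨y, X y⟩ : TangentBundle I M)) x →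
    MDifferentiableAt I I.tangent (fun y ↦ (⟨y, Y y⟩ : TangentBundle I M)) x →
    D Y x (X x) - D X x (Y x) = VectorField.mlieBracket I X Y x

/-- The curvature `R(X, Y)Z = ∇_X ∇_Y Z - ∇_Y ∇_X Z - ∇_{[X, Y]} Z`. -/
def curvatureField (D : AffineConnection I M) (X Y Z : Π x : M, TangentSpace I x) (x : M) :
    TangentSpace I x :=
  D (fun y ↦ D Z y (Y y)) x (X x) - D (fun y ↦ D Z y (X y)) x (Y x)
    - D Z x (VectorField.mlieBracket I X Y x)

/-- The sectional curvature
`K(X, Y) = g(R(X, Y)Y, X) / (g(X, X) g(Y, Y) - g(X, Y)²)` of the metric `g` with Levi-Civita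
connection `D`, for two vector fields `X` and `Y`, at the point `x`. -/
def sectionalCurvature (g : SmoothRiemannianMetric I M) (D : AffineConnection I M)
    (X Y : Π x : M, TangentSpace I x) (x : M) : ℝ :=
  g.inner x (curvatureField D X Y Y x) (X x) /
    (g.inner x (X x) (X x) * g.inner x (Y x) (Y x) - g.inner x (X x) (Y x) ^ 2)

/-- The vertical lift `X^v` of a vector field `X` on `M`: its value at `(x, y) ∈ TM` is the velocity
at `t = 0` of the curve `t ↦ (x, y + t X(x))`. -/
def verticalLift (X : Π x : M, TangentSpace I x) (p : TangentBundle I M) :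
    TangentSpace I.tangent p :=
  mfderiv 𝓘(ℝ, ℝ) I.tangent
    (fun t : ℝ ↦ (⟨p.proj, p.snd + t • X p.proj⟩ : TangentBundle I M)) 0 (1 : ℝ)

/-- The complete lift `X^c` of a vector field `X` on `M` (the vector field generated by `Tφ_t`, if
`φ_t` is the flow of `X`), written as `X^c = κ ∘ TX`, where `κ` is the canonical flip of `TTM`.

Every `T_{(x, y)}TM` is `E × E`, through the chart of `TM` at `(x, y)`, and this is the chart that
the preferred chart of `M` at `x` induces. If `X` reads `ξ` in that chart of `M`, then
`TX (x, y) = ((x, X(x)), (y, Dξ(x) y))`, and the flip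
`((x, a), (b, w)) ↦ ((x, b), (a, w))` sends it to the usual expression
`X^c (x, y) = (X(x), Dξ(x) y)`. -/
def completeLift (X : Π x : M, TangentSpace I x) (p : TangentBundle I M) :
    TangentSpace I.tangent p :=
  let TX : E × E :=
    mfderiv I I.tangent (fun y ↦ (⟨y, X y⟩ : TangentBundle I M)) p.proj p.snd
  ((X p.proj, TX.2) : E × E)

end RiemannianGeometry

section LieGroups

variable {E : Type*} [NormedAddCommGroup E] [NormedSpace ℝ E]
  {H : Type*} [TopologicalSpace H] {I : ModelWithCorners ℝ E H}
  {G : Type*} [TopologicalSpace G] [ChartedSpace H G] [Group G]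

/-- A Riemannian metric on `G` is left invariant if all left translations are isometries. -/
def IsLeftInvariantMetric [IsManifold I ∞ G] (g : SmoothRiemannianMetric I G) : Prop :=
  ∀ (a b : G) (v w : TangentSpace I b),
    g.inner (a * b) (mfderiv I I (fun x ↦ a * x) b v) (mfderiv I I (fun x ↦ a * x) b w)
      = g.inner b v w

/-- The multiplication `Tμ (v, w) = T_h L_g w + T_g R_h v` of the tangent Lie group `TG`, for
`v ∈ T_g G` and `w ∈ T_h G`. -/
def tangentMul (p q : TangentBundle I G) : TangentBundle I G :=
  ⟨p.proj * q.proj,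
    mfderiv I I (fun x ↦ p.proj * x) q.proj q.snd + mfderiv I I (fun x ↦ x * q.proj) p.proj p.snd⟩

/-- `gt` is the left invariant Riemannian metric on the tangent Lie group `TG` that is defined by
`gt(X^c, Y^c) = g₁(X, Y)`, `gt(X^v, Y^v) = g₂(X, Y)`, `gt(X^c, Y^v) = 0` for all left invariant
vector fields `X`, `Y` on `G`, where `g₁` and `g₂` are left invariant Riemannian metrics on `G`.
(The complete and vertical lifts of left invariant vector fields span every tangent space
of `TG`, so there is only one such metric.) -/
structure IsLiftedMetric [IsManifold I ∞ G] (g₁ g₂ : SmoothRiemannianMetric I G)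
    (gt : SmoothRiemannianMetric I.tangent (TangentBundle I G)) : Prop where
  leftInvariant : ∀ (a p : TangentBundle I G) (v w : TangentSpace I.tangent p),
    gt.inner (tangentMul a p) (mfderiv I.tangent I.tangent (tangentMul a) p v)
      (mfderiv I.tangent I.tangent (tangentMul a) p w) = gt.inner p v w
  complete_complete : ∀ (X Y : GroupLieAlgebra I G) (p : TangentBundle I G),
    gt.inner p (completeLift (mulInvariantVectorField X) p)
      (completeLift (mulInvariantVectorField Y) p) = g₁.inner 1 X Y
  vertical_vertical : ∀ (X Y : GroupLieAlgebra I G) (p : TangentBundle I G),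
    gt.inner p (verticalLift (mulInvariantVectorField X) p)
      (verticalLift (mulInvariantVectorField Y) p) = g₂.inner 1 X Y
  complete_vertical : ∀ (X Y : GroupLieAlgebra I G) (p : TangentBundle I G),
    gt.inner p (completeLift (mulInvariantVectorField X) p)
      (verticalLift (mulInvariantVectorField Y) p) = 0

/-- The complete lift of the left invariant vector field on `G` with value `X` at the identity. -/
def liftC (X : GroupLieAlgebra I G) [IsManifold I ∞ G] :
    Π p : TangentBundle I G, TangentSpace I.tangent p :=
  completeLift (mulInvariantVectorField X)

/-- The vertical lift of the left invariant vector field on `G` with value `X` at the identity. -/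
def liftV (X : GroupLieAlgebra I G) [IsManifold I ∞ G] :
    Π p : TangentBundle I G, TangentSpace I.tangent p :=
  verticalLift (mulInvariantVectorField X)

end LieGroups

end

/-! Both $(G,g^1)$ and $(TG,\tilde g)$ carry a global orthonormal frame with constant structure
constants: the $X_i$ on $G$, and the $X_i^c$, $X_i^v/\sqrt{\lambda_i}$ on $TG$. In such a frame the
Koszul formula has no derivative terms, so the Christoffel symbols are constants and the sectional
curvature is a fixed quadratic polynomial in the structure constants, Milnor's formula
(`IsOrthonormalFrame.sectionalCurvature_eq`). The three formulas are this polynomial evaluated on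
the frame of $TG$, and $K^1$ is the same polynomial evaluated on the $X_i$.

The structure constants on $TG$ follow from $[X^c,Y^c]=[X,Y]^c$, $[X^c,Y^v]=[X,Y]^v$, $[X^v,Y^v]=0$
(`mlieBracket_completeLift` and its companions). On a vector space these are short computations with
first and second derivatives. To move them to a manifold, `mfderiv_extChartAt_completeLift` and
`mfderiv_extChartAt_verticalLift` show that the lifts, defined at each point through the chart
belonging to that point, have the expected expression in any one fixed chart; brackets then pull
back along that chart. -/

/-! ### Curvature of orthonormal frames with constant structure constants. -/

section OrthonormalFrames

open VectorField

variable {E : Type*} [NormedAddCommGroup E] [NormedSpace ℝ E] [FiniteDimensional ℝ E]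
  {H : Type*} [TopologicalSpace H] {I : ModelWithCorners ℝ E H}
  {M : Type*} [TopologicalSpace M] [ChartedSpace H M] [IsManifold I ∞ M]

/-- A family of differentiable vector fields that is a `g`-orthonormal basis of each tangent space,
and whose Lie brackets have the constant structure constants `α`. -/
structure IsOrthonormalFrame {ι : Type*} [Fintype ι] [DecidableEq ι]
    (g : SmoothRiemannianMetric I M) (e : ι → Π x : M, TangentSpace I x)
    (α : ι → ι → ι → ℝ) : Prop where
  mdifferentiableAt : ∀ a x,
    MDifferentiableAt I I.tangent (fun y ↦ (⟨y, e a y⟩ : TangentBundle I M)) x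
  inner_eq : ∀ a b x, g.inner x (e a x) (e b x) = if a = b then 1 else 0
  bracket : ∀ a b x, mlieBracket I (e a) (e b) x = ∑ k, α a b k • e k x
  card_eq : Fintype.card ι = Module.finrank ℝ E

/-- The Christoffel symbols of an orthonormal frame with structure constants `α`. -/
noncomputable def frameChristoffel {ι : Type*} (α : ι → ι → ι → ℝ) (a b k : ι) : ℝ :=
  1 / 2 * (α a b k - α b k a + α k a b)

-- Differentiability is carried along in the induction because additivity of `D` requires it of each
-- partial sum.
omit [FiniteDimensional ℝ E] in
lemma AffineConnection.sum_const_smul (D : AffineConnection I M) {ι : Type*} (s : Finset ι)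
    (e : ι → Π x : M, TangentSpace I x) (r : ι → ℝ) (x : M)
    (he : ∀ a, MDifferentiableAt I I.tangent (fun y ↦ (⟨y, e a y⟩ : TangentBundle I M)) x) :
    MDifferentiableAt I I.tangent
      (fun y ↦ (⟨y, ∑ k ∈ s, r k • e k y⟩ : TangentBundle I M)) x ∧
    D (fun y ↦ ∑ k ∈ s, r k • e k y) x = ∑ k ∈ s, r k • D (e k) x := by
  classical
  induction s using Finset.induction_on with
  | empty =>
    simp only [Finset.sum_empty]
    exact ⟨mdifferentiableAt_zeroSection ℝ (TangentSpace I : M → Type _),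
      congrFun (CovariantDerivative.zero D) x⟩
  | insert a s ha ih =>
    have h1 : MDifferentiableAt I I.tangent
        (fun y ↦ (⟨y, (r a • e a) y⟩ : TangentBundle I M)) x :=
      MDifferentiableAt.smul_const_section (he a)
    simp only [Finset.sum_insert ha]
    refine ⟨mdifferentiableAt_add_section h1 ih.1, ?_⟩
    have := D.isCovariantDerivativeOnUniv.add h1 ih.1
    rw [D.isCovariantDerivativeOnUniv.smul_const (r a) (he a), ih.2] at this
    exact this

namespace IsOrthonormalFrame

variable {ι : Type*} [Fintype ι] [DecidableEq ι] {g : SmoothRiemannianMetric I M}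
  {e : ι → Π x : M, TangentSpace I x} {α : ι → ι → ι → ℝ} {D : AffineConnection I M}

lemma sum_inner_smul (h : IsOrthonormalFrame g e α) (x : M) (v : TangentSpace I x) :
    v = ∑ k, g.inner x v (e k x) • e k x := by
  have hli : LinearIndependent ℝ (fun k ↦ e k x) := by
    rw [Fintype.linearIndependent_iff]
    intro r hr k
    have := congrArg (fun w ↦ g.inner x w (e k x)) hr
    simpa [h.inner_eq] using this
  have : FiniteDimensional ℝ (TangentSpace I x) := inferInstanceAs (FiniteDimensional ℝ E)
  have hspan := hli.span_eq_top_of_card_eq_finrank' h.card_eq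
  obtain ⟨r, hr⟩ := (Submodule.mem_span_range_iff_exists_fun ℝ).1
    (hspan ▸ Submodule.mem_top : v ∈ Submodule.span ℝ (Set.range fun k ↦ e k x))
  subst hr
  simp [h.inner_eq]

/-- Koszul's argument. The products $g(e_b,e_c)$ are constant, so metricity makes
$g(\nabla_{e_a}e_b,e_c)$ antisymmetric in $b,c$; vanishing torsion makes its antisymmetrization in
$a,b$ equal to $\alpha$. The three cyclic instances of each determine it. -/
lemma inner_connection (h : IsOrthonormalFrame g e α) (hD : IsLeviCivita g D) (a b k : ι) (x : M) :
    g.inner x (D (e b) x (e a x)) (e k x) = frameChristoffel α a b k := by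
  have hm : ∀ a b c, g.inner x (D (e b) x (e a x)) (e c x)
      = - g.inner x (D (e c) x (e a x)) (e b x) := by
    intro a b c
    have := hD.metric (e b) (e c) x (e a x) (h.mdifferentiableAt b x) (h.mdifferentiableAt c x)
    have h0 : (fun y ↦ g.inner y (e b y) (e c y)) = fun _ ↦ if b = c then 1 else 0 :=
      funext fun y ↦ h.inner_eq b c y
    rw [h0, g.symm x (e b x)] at this
    simp [mvfderiv] at this
    linarith
  have ht : ∀ a b c, g.inner x (D (e b) x (e a x)) (e c x)
      - g.inner x (D (e a) x (e b x)) (e c x) = α a b c := by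
    intro a b c
    have := hD.torsionFree (e a) (e b) x (h.mdifferentiableAt a x) (h.mdifferentiableAt b x)
    have := congrArg (fun w ↦ g.inner x w (e c x)) this
    simpa [h.bracket, h.inner_eq] using this
  have h1 := ht a b k
  have h2 := ht b k a
  have h3 := ht k a b
  have h4 := hm a b k
  have h5 := hm b k a
  have h6 := hm k a b
  simp only [frameChristoffel]
  linarith

lemma connection (h : IsOrthonormalFrame g e α) (hD : IsLeviCivita g D) (a b : ι) (x : M) :
    D (e b) x (e a x) = ∑ k, frameChristoffel α a b k • e k x := by
  rw [h.sum_inner_smul x (D (e b) x (e a x))]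
  simp only [h.inner_connection hD]

omit [FiniteDimensional ℝ E] in
lemma structureConstant_antisymm (h : IsOrthonormalFrame g e α) (x : M) (a b k : ι) :
    α a b k = - α b a k := by
  have := congrArg (fun w ↦ g.inner x w (e k x)) (mlieBracket_swap_apply (V := e a) (W := e b)
    (I := I) (x := x))
  simpa [h.bracket, h.inner_eq] using this

/-- Milnor's formula for the sectional curvature of an orthonormal frame with constant structure
constants. -/
theorem sectionalCurvature_eq (h : IsOrthonormalFrame g e α) (hD : IsLeviCivita g D)
    {a b : ι} (hab : a ≠ b) (x : M) :
    sectionalCurvature g D (e a) (e b) x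
      = ∑ k, (1 / 2 * α a b k * (-α a b k + α b k a + α k a b)
          - 1 / 4 * (α a b k - α b k a + α k a b) * (α a b k + α b k a - α k a b)
          - α k a a * α k b b) := by
  -- Constant Christoffel symbols pass through the outer derivative, so no derivatives of them
  -- appear.
  have hcov : ∀ a b c, D (fun y ↦ D (e c) y (e b y)) x (e a x)
      = ∑ k, frameChristoffel α b c k • ∑ l, frameChristoffel α a k l • e l x := by
    intro a b c
    rw [show (fun y ↦ D (e c) y (e b y)) = fun y ↦ ∑ k, frameChristoffel α b c k • e k y from
      funext fun y ↦ h.connection hD b c y,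
      (AffineConnection.sum_const_smul D _ e _ x fun a ↦ h.mdifferentiableAt a x).2]
    simp [h.connection hD]
  have hbr : D (e b) x (mlieBracket I (e a) (e b) x)
      = ∑ k, α a b k • ∑ l, frameChristoffel α k b l • e l x := by
    simp [h.bracket, h.connection hD]
  have hden : g.inner x (e a x) (e a x) * g.inner x (e b x) (e b x)
      - g.inner x (e a x) (e b x) ^ 2 = 1 := by
    simp [h.inner_eq, hab]
  rw [sectionalCurvature, hden, div_one, curvatureField, hcov, hcov, hbr]
  simp only [map_sub, map_sum, map_smul, sub_apply,
    sum_apply, smul_apply, h.inner_eq, smul_eq_mul,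
    mul_ite, mul_one, mul_zero, Finset.sum_ite_eq', Finset.mem_univ, if_true]
  rw [← Finset.sum_sub_distrib, ← Finset.sum_sub_distrib]
  refine Finset.sum_congr rfl fun k _ ↦ ?_
  -- The two sides agree summand by summand once antisymmetry brings every structure constant to one
  -- chosen order of its first two indices.
  have anti := h.structureConstant_antisymm x
  have e1 := anti a k a
  have e2 : α a a k = 0 := by linarith [anti a a k]
  have e3 := anti b k b
  have e4 : α b b k = 0 := by linarith [anti b b k]
  have e5 := anti k b a
  have e6 := anti b a k
  have e7 := anti a k b
  simp only [frameChristoffel, e1, e2, e3, e4, e5, e6, e7]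
  ring

end IsOrthonormalFrame

end OrthonormalFrames

/-! ### Lifts and their brackets on a vector space. -/

section ModelLifts

open VectorField

variable {E : Type*} [NormedAddCommGroup E] [NormedSpace ℝ E]

/-- The complete lift to `E × E` of a vector field on the vector space `E`. -/
noncomputable def modelCompleteLift (ξ : E → E) (z : E × E) : E × E :=
  (ξ z.1, fderiv ℝ ξ z.1 z.2)

/-- The vertical lift to `E × E` of a vector field on the vector space `E`. -/
def modelVerticalLift (ξ : E → E) (z : E × E) : E × E :=
  (0, ξ z.1)

variable {ξ η : E → E} {z : E × E}

lemma hasFDerivAt_modelVerticalLift (hξ : DifferentiableAt ℝ ξ z.1) :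
    HasFDerivAt (modelVerticalLift ξ)
      ((0 : E × E →L[ℝ] E).prod ((fderiv ℝ ξ z.1).comp (.fst ℝ E E))) z :=
  (hasFDerivAt_const _ _).prodMk (hξ.hasFDerivAt.comp z hasFDerivAt_fst)

lemma hasFDerivAt_modelCompleteLift (hξ : ContDiffAt ℝ 2 ξ z.1) :
    HasFDerivAt (modelCompleteLift ξ)
      (((fderiv ℝ ξ z.1).comp (.fst ℝ E E)).prod
        ((fderiv ℝ ξ z.1).comp (.snd ℝ E E) +
          ((fderiv ℝ (fderiv ℝ ξ) z.1).comp (.fst ℝ E E)).flip z.2)) z := by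
  have h1 : DifferentiableAt ℝ ξ z.1 := hξ.differentiableAt (by norm_num)
  have h2 : DifferentiableAt ℝ (fderiv ℝ ξ) z.1 :=
    (hξ.fderiv_right (m := 1) (by norm_num)).differentiableAt (by norm_num)
  exact (h1.hasFDerivAt.comp z hasFDerivAt_fst).prodMk
    ((h2.hasFDerivAt.comp z hasFDerivAt_fst).clm_apply hasFDerivAt_snd)

lemma lieBracket_modelVerticalLift (hξ : DifferentiableAt ℝ ξ z.1)
    (hη : DifferentiableAt ℝ η z.1) :
    lieBracket ℝ (modelVerticalLift ξ) (modelVerticalLift η) z = 0 := by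
  rw [lieBracket, (hasFDerivAt_modelVerticalLift hξ).fderiv,
    (hasFDerivAt_modelVerticalLift hη).fderiv]
  simp [modelVerticalLift]

lemma lieBracket_modelCompleteLift_modelVerticalLift (hξ : ContDiffAt ℝ 2 ξ z.1)
    (hη : DifferentiableAt ℝ η z.1) :
    lieBracket ℝ (modelCompleteLift ξ) (modelVerticalLift η) z
      = modelVerticalLift (lieBracket ℝ ξ η) z := by
  rw [lieBracket, (hasFDerivAt_modelCompleteLift hξ).fderiv,
    (hasFDerivAt_modelVerticalLift hη).fderiv]
  simp [modelVerticalLift, modelCompleteLift, lieBracket]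

/-- Both second components contain the same first-derivative terms; the second-derivative terms
differ only in the order of their arguments, so symmetry of $D^2\xi$ and $D^2\eta$ identifies them.
-/
lemma lieBracket_modelCompleteLift (hξ : ContDiffAt ℝ 2 ξ z.1) (hη : ContDiffAt ℝ 2 η z.1) :
    lieBracket ℝ (modelCompleteLift ξ) (modelCompleteLift η) z
      = modelCompleteLift (lieBracket ℝ ξ η) z := by
  have h1 : ∀ {ξ : E → E}, ContDiffAt ℝ 2 ξ z.1 → DifferentiableAt ℝ ξ z.1 :=
    fun h ↦ h.differentiableAt (by norm_num)
  have h2 : ∀ {ξ : E → E}, ContDiffAt ℝ 2 ξ z.1 → DifferentiableAt ℝ (fderiv ℝ ξ) z.1 :=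
    fun h ↦ (h.fderiv_right (m := 1) (by norm_num)).differentiableAt (by norm_num)
  have hbr : HasFDerivAt (lieBracket ℝ ξ η) _ z.1 :=
    ((h2 hη).hasFDerivAt.clm_apply (h1 hξ).hasFDerivAt).sub
      ((h2 hξ).hasFDerivAt.clm_apply (h1 hη).hasFDerivAt)
  have sξ := (hξ.isSymmSndFDerivAt (by simp)).eq
  have sη := (hη.isSymmSndFDerivAt (by simp)).eq
  rw [modelCompleteLift, hbr.fderiv, lieBracket, (hasFDerivAt_modelCompleteLift hξ).fderiv,
    (hasFDerivAt_modelCompleteLift hη).fderiv]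
  simp only [modelCompleteLift, lieBracket, ContinuousLinearMap.prod_apply,
    ContinuousLinearMap.comp_apply, ContinuousLinearMap.coe_fst', ContinuousLinearMap.coe_snd',
    add_apply, sub_apply, ContinuousLinearMap.flip_apply, Prod.mk_sub_mk, sξ z.2, sη z.2]

end ModelLifts

/-! ### Vector fields and their brackets read in a chart. -/

section ChartReading

open VectorField

variable {E : Type*} [NormedAddCommGroup E] [NormedSpace ℝ E]

lemma mlieBracket_eq_lieBracket (V W : E → E) (x : E) :
    mlieBracket 𝓘(ℝ, E) V W x = lieBracket ℝ V W x :=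
  (congrFun mlieBracketWithin_univ x).symm.trans
    ((congrFun mlieBracketWithin_eq_lieBracketWithin x).trans (congrFun lieBracketWithin_univ x))

variable {H : Type*} [TopologicalSpace H] {I : ModelWithCorners ℝ E H}
  {M : Type*} [TopologicalSpace M] [ChartedSpace H M] [IsManifold I ∞ M]

lemma trivializationAt_snd_eq_mfderiv {x₀ x : M} (hx : x ∈ (extChartAt I x₀).source)
    (v : TangentSpace I x) :
    (trivializationAt E (TangentSpace I : M → Type _) x₀ ⟨x, v⟩).2
      = mfderiv I 𝓘(ℝ, E) (extChartAt I x₀) x v := by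
  rw [extChartAt_source] at hx
  have h := congrArg (fun f ↦ f v)
    (TangentBundle.continuousLinearMapAt_trivializationAt (I := I) hx)
  refine Eq.trans ?_ h
  exact (congrFun (Trivialization.coe_linearMapAt_of_mem (R := ℝ) _ (by simpa using hx)) v).symm

lemma extChartAt_tangentBundle_apply (p q : TangentBundle I M) :
    extChartAt I.tangent p q = (extChartAt I p.proj q.proj,
      (trivializationAt E (TangentSpace I : M → Type _) p.proj q).2) := by
  rfl

lemma mem_extChartAt_tangentBundle_source {p q : TangentBundle I M} :
    q ∈ (extChartAt I.tangent p).source ↔ q.proj ∈ (extChartAt I p.proj).source := by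
  simp

lemma trivializationAt_extChartAt_tangentBundle_symm {p : TangentBundle I M} {z : E × E}
    (hz : z.1 ∈ (extChartAt I p.proj).target) :
    (trivializationAt E (TangentSpace I : M → Type _) p.proj
      ((extChartAt I.tangent p).symm z)).2 = z.2 := by
  have : z ∈ (extChartAt I.tangent p).target := by
    rw [extChartAt_target, Set.mem_inter_iff, Set.mem_preimage] at hz ⊢
    obtain ⟨y, hy⟩ := hz.2
    exact ⟨(TangentBundle.mem_chart_target_iff _ _).2 hz.1, (y, z.2), Prod.ext hy rfl⟩
  have := (extChartAt I.tangent p).right_inv this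
  rw [extChartAt_tangentBundle_apply] at this
  exact congrArg Prod.snd this

/-- The vector field on the model space that a vector field reads in the chart at `x₀`. -/
noncomputable def chartReading (x₀ : M) (X : Π x : M, TangentSpace I x) (u : E) : E :=
  (trivializationAt E (TangentSpace I : M → Type _) x₀
    ⟨(extChartAt I x₀).symm u, X ((extChartAt I x₀).symm u)⟩).2

lemma contDiffOn_chartReading (x₀ : M) {X : Π x : M, TangentSpace I x}
    (hX : ContMDiff I I.tangent 2 (fun y ↦ (⟨y, X y⟩ : TangentBundle I M))) :
    ContDiffOn ℝ 2 (chartReading x₀ X) (extChartAt I x₀).target := by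
  have h1 := (Trivialization.contMDiffOn_section_baseSet_iff (IB := I) (n := 2)
    (trivializationAt E (TangentSpace I : M → Type _) x₀)).1 hX.contMDiffOn
  rw [← contMDiffOn_iff_contDiffOn]
  refine h1.comp (contMDiffOn_extChartAt_symm x₀) ?_
  intro u hu
  simpa using (extChartAt I x₀).map_target hu

/-- The derivatives of a chart and of its inverse are mutually inverse. This form gives access to
the naturality of `mlieBracket` under pullback. -/
lemma chartReading_eqOn_mpullback [I.Boundaryless] (x₀ : M) (X : Π x : M, TangentSpace I x) :
    Set.EqOn (chartReading x₀ X)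
      (mpullback 𝓘(ℝ, E) I (extChartAt I x₀).symm X) (extChartAt I x₀).target := by
  intro u hu
  have hx := (extChartAt I x₀).map_target hu
  rw [chartReading, trivializationAt_snd_eq_mfderiv hx]
  have := mfderiv_extChartAt_comp_mfderivWithin_extChartAt_symm (I := I) hu
  rw [I.range_eq_univ, mfderivWithin_univ] at this
  have h2 := mfderivWithin_extChartAt_symm_comp_mfderiv_extChartAt (I := I) hu
  rw [I.range_eq_univ, mfderivWithin_univ] at h2
  rw [mpullback_apply, ContinuousLinearMap.inverse_eq h2 this]
  rfl

lemma chartReading_mlieBracket [I.Boundaryless] [CompleteSpace E] (x₀ : M)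
    {X Y : Π x : M, TangentSpace I x}
    (hX : ContMDiff I I.tangent 2 (fun y ↦ (⟨y, X y⟩ : TangentBundle I M)))
    (hY : ContMDiff I I.tangent 2 (fun y ↦ (⟨y, Y y⟩ : TangentBundle I M))) :
    Set.EqOn (chartReading x₀ (mlieBracket I X Y))
      (lieBracket ℝ (chartReading x₀ X) (chartReading x₀ Y)) (extChartAt I x₀).target := by
  intro u hu
  have hnhds : (extChartAt I x₀).target ∈ nhds u := (isOpen_extChartAt_target x₀).mem_nhds hu
  have : IsManifold I (minSmoothness ℝ 2) M := by
    rw [minSmoothness_of_isRCLikeNormedField]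
    infer_instance
  rw [chartReading_eqOn_mpullback x₀ _ hu, mpullback_mlieBracket (n := 2)
    (hX.mdifferentiable (by norm_num) _) (hY.mdifferentiable (by norm_num) _)
    ((contMDiffOn_extChartAt_symm x₀).contMDiffAt hnhds)
    (by rw [minSmoothness_of_isRCLikeNormedField])]
  refine (mlieBracket_eq_lieBracket _ _ u).trans ?_
  exact (Filter.EventuallyEq.lieBracket_vectorField_eq
    ((chartReading_eqOn_mpullback x₀ X).eventuallyEq_of_mem hnhds)
    ((chartReading_eqOn_mpullback x₀ Y).eventuallyEq_of_mem hnhds)).symm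

end ChartReading

/-! ### Lifts read in a fixed chart of the tangent bundle. -/

section LiftsInCharts

open VectorField

variable {E : Type*} [NormedAddCommGroup E] [NormedSpace ℝ E]
  {H : Type*} [TopologicalSpace H] {I : ModelWithCorners ℝ E H} [I.Boundaryless]
  {M : Type*} [TopologicalSpace M] [ChartedSpace H M] [IsManifold I ∞ M]

variable (I) in
/-- The transition map from the chart at `x₁` to the chart at `x₀`. -/
noncomputable def chartTransition (x₀ x₁ : M) (u : E) : E :=
  extChartAt I x₀ ((extChartAt I x₁).symm u)

lemma contDiffAt_chartTransition {x₀ x₁ y : M} (h₀ : y ∈ (extChartAt I x₀).source)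
    (h₁ : y ∈ (extChartAt I x₁).source) :
    ContDiffAt ℝ 2 (chartTransition I x₀ x₁) (extChartAt I x₁ y) := by
  rw [← contMDiffAt_iff_contDiffAt]
  refine ContMDiffAt.comp (I' := I) (g := extChartAt I x₀) _ ?_
    ((contMDiffOn_extChartAt_symm x₁).contMDiffAt
      ((isOpen_extChartAt_target x₁).mem_nhds ((extChartAt I x₁).map_source h₁)))
  rw [(extChartAt I x₁).left_inv h₁]
  exact contMDiffAt_extChartAt' (by simpa using h₀)

lemma trivializationAt_snd_transition {x₀ x₁ y : M} (h₀ : y ∈ (extChartAt I x₀).source)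
    (h₁ : y ∈ (extChartAt I x₁).source) (v : TangentSpace I y) :
    (trivializationAt E (TangentSpace I : M → Type _) x₀ ⟨y, v⟩).2
      = fderiv ℝ (chartTransition I x₀ x₁) (extChartAt I x₁ y)
        (trivializationAt E (TangentSpace I : M → Type _) x₁ ⟨y, v⟩).2 := by
  -- Tangent vectors at `y` are coordinates in the preferred chart at `y`; the cocycle rule factors
  -- the change to `x₀` through `x₁`.
  have h := tangentCoordChange_comp (I := I) (w := y) (x := x₁) (y := x₀) (z := y) (v := v)
    ⟨⟨mem_extChartAt_source y, h₁⟩, h₀⟩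
  rw [tangentCoordChange_def (x := x₁), I.range_eq_univ, fderivWithin_univ] at h
  exact h.symm

omit [I.Boundaryless] in
lemma trivializationAt_snd_self (p : TangentBundle I M) :
    (trivializationAt E (TangentSpace I : M → Type _) p.proj p).2 = p.snd :=
  tangentCoordChange_self (I := I) (mem_extChartAt_source p.proj)

omit [I.Boundaryless] in
lemma chartReading_apply_self (X : Π x : M, TangentSpace I x) (x : M) :
    chartReading x X (extChartAt I x x) = X x := by
  rw [chartReading, (extChartAt I x).left_inv (mem_extChartAt_source x)]
  exact trivializationAt_snd_self ⟨x, X x⟩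

lemma chartReading_chartTransition (X : Π x : M, TangentSpace I x) {x₀ x₁ : M} {u : E}
    (hu : u ∈ (extChartAt I x₁).target)
    (hu' : (extChartAt I x₁).symm u ∈ (extChartAt I x₀).source) :
    chartReading x₀ X (chartTransition I x₀ x₁ u)
      = fderiv ℝ (chartTransition I x₀ x₁) u (chartReading x₁ X u) := by
  have := trivializationAt_snd_transition hu' ((extChartAt I x₁).map_target hu)
    (X ((extChartAt I x₁).symm u))
  rw [(extChartAt I x₁).right_inv hu] at this
  rw [chartReading, chartTransition, (extChartAt I x₀).left_inv hu']
  exact this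

lemma completeLift_eq {X : Π x : M, TangentSpace I x}
    (hX : ContMDiff I I.tangent 2 (fun y ↦ (⟨y, X y⟩ : TangentBundle I M)))
    (p : TangentBundle I M) :
    completeLift X p = ((X p.proj, fderiv ℝ (chartReading p.proj X)
      (extChartAt I p.proj p.proj) p.snd) : E × E) := by
  have hd := hX.mdifferentiable (by norm_num) p.proj
  have hnhds := (isOpen_extChartAt_target (I := I) p.proj).mem_nhds (mem_extChartAt_target p.proj)
  have hξ : DifferentiableAt ℝ (chartReading p.proj X) (extChartAt I p.proj p.proj) :=
    ((contDiffOn_chartReading p.proj hX).contDiffAt hnhds).differentiableAt (by norm_num)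
  -- In the chart the section is $u\mapsto(u,\xi(u))$; its first component is the identity only on
  -- the chart's target.
  have hid : HasFDerivAt (fun u ↦ extChartAt I p.proj ((extChartAt I p.proj).symm u))
      (ContinuousLinearMap.id ℝ E) (extChartAt I p.proj p.proj) :=
    (hasFDerivAt_id _).congr_of_eventuallyEq
      (Filter.eventuallyEq_of_mem hnhds fun u hu ↦ (extChartAt I p.proj).right_inv hu)
  have hw : HasFDerivAt (writtenInExtChartAt I I.tangent p.proj
      (fun y ↦ (⟨y, X y⟩ : TangentBundle I M))) _ (extChartAt I p.proj p.proj) :=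
    hid.prodMk hξ.hasFDerivAt
  have h := hd.mfderiv
  rw [I.range_eq_univ, fderivWithin_univ, hw.fderiv] at h
  rw [completeLift, h]
  rfl

omit [I.Boundaryless] in
lemma verticalLift_eq (X : Π x : M, TangentSpace I x) (p : TangentBundle I M) :
    verticalLift X p = ((0, X p.proj) : E × E) := by
  have hfun : (fun t : ℝ ↦ (trivializationAt E (TangentSpace I : M → Type _) p.proj
      (⟨p.proj, p.snd + t • X p.proj⟩ : TangentBundle I M)).2)
      = fun t ↦ ((p.snd + t • X p.proj : TangentSpace I p.proj) : E) :=
    funext fun t ↦ trivializationAt_snd_self ⟨p.proj, p.snd + t • X p.proj⟩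
  have hline : ∀ a b : E, HasFDerivAt (fun t : ℝ ↦ a + t • b)
      ((ContinuousLinearMap.id ℝ ℝ).smulRight b) 0 :=
    fun a b ↦ ((hasFDerivAt_id (𝕜 := ℝ) (0 : ℝ)).smul_const b).const_add a
  have hder : HasFDerivAt (fun t : ℝ ↦ (trivializationAt E (TangentSpace I : M → Type _) p.proj
      (⟨p.proj, p.snd + t • X p.proj⟩ : TangentBundle I M)).2)
      ((ContinuousLinearMap.id ℝ ℝ).smulRight (X p.proj : E)) 0 := by
    rw [hfun]
    exact hline p.snd (X p.proj)
  have hd : MDifferentiableAt 𝓘(ℝ, ℝ) I.tangent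
      (fun t : ℝ ↦ (⟨p.proj, p.snd + t • X p.proj⟩ : TangentBundle I M)) 0 :=
    (mdifferentiableAt_totalSpace _ _).2
      ⟨mdifferentiableAt_const, hder.differentiableAt.mdifferentiableAt⟩
  have hw : HasFDerivAt (writtenInExtChartAt 𝓘(ℝ, ℝ) I.tangent (0 : ℝ)
      (fun t : ℝ ↦ (⟨p.proj, p.snd + t • X p.proj⟩ : TangentBundle I M))) _ (0 : ℝ) :=
    (hasFDerivAt_const (𝕜 := ℝ) (extChartAt I p.proj p.proj) (0 : ℝ)).prodMk hder
  have h := hd.mfderiv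
  rw [modelWithCornersSelf_coe, Set.range_id, fderivWithin_univ] at h
  have h' : mfderiv 𝓘(ℝ, ℝ) I.tangent
      (fun t : ℝ ↦ (⟨p.proj, p.snd + t • X p.proj⟩ : TangentBundle I M)) 0 = _ := h.trans hw.fderiv
  rw [verticalLift, h']
  refine Prod.ext rfl ?_
  exact one_smul ℝ (X p.proj : E)

/-- If $\tau$ is the transition map of the base, the transition map of the tangent bundle is
$(u,w)\mapsto(\tau(u),D\tau(u)w)$, which is `modelCompleteLift` applied to $\tau$. -/
lemma mfderiv_extChartAt_tangentBundle {p₀ p : TangentBundle I M}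
    (hp : p.proj ∈ (extChartAt I p₀.proj).source) (v : TangentSpace I.tangent p) :
    mfderiv I.tangent 𝓘(ℝ, E × E) (extChartAt I.tangent p₀) p v
      = fderiv ℝ (modelCompleteLift (chartTransition I p₀.proj p.proj))
          (extChartAt I p.proj p.proj, p.snd) v := by
  have hd : MDifferentiableAt I.tangent 𝓘(ℝ, E × E) (extChartAt I.tangent p₀) p :=
    mdifferentiableAt_extChartAt (by simpa using hp)
  have hpt : extChartAt I.tangent p p = (extChartAt I p.proj p.proj, p.snd) :=
    Prod.ext rfl (trivializationAt_snd_self p)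
  have h := hd.mfderiv
  have hrange : Set.range I.tangent = Set.univ := I.tangent.range_eq_univ
  rw [hrange, fderivWithin_univ, hpt] at h
  have heq : writtenInExtChartAt I.tangent 𝓘(ℝ, E × E) p (extChartAt I.tangent p₀)
      =ᶠ[nhds ((extChartAt I p.proj p.proj, p.snd) : E × E)]
      modelCompleteLift (chartTransition I p₀.proj p.proj) := by
    have hc : ContinuousAt (fun z : E × E ↦ (extChartAt I p.proj).symm z.1)
        (extChartAt I p.proj p.proj, p.snd) :=
      (continuousAt_extChartAt_symm p.proj).comp (f := Prod.fst) continuousAt_fst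
    have h1 : ∀ᶠ z : E × E in nhds (extChartAt I p.proj p.proj, p.snd),
        z.1 ∈ (extChartAt I p.proj).target :=
      continuousAt_fst.eventually_mem
        ((isOpen_extChartAt_target p.proj).mem_nhds (mem_extChartAt_target p.proj))
    have h2 : ∀ᶠ z : E × E in nhds (extChartAt I p.proj p.proj, p.snd),
        (extChartAt I p.proj).symm z.1 ∈ (extChartAt I p₀.proj).source :=
      hc.eventually_mem ((isOpen_extChartAt_source (I := I) p₀.proj).mem_nhds (by simpa using hp))
    filter_upwards [h1, h2] with z hz hz'
    refine Prod.ext rfl ?_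
    have := trivializationAt_snd_transition hz' ((extChartAt I p.proj).map_target hz)
      ((extChartAt I.tangent p).symm z).snd
    rw [(extChartAt I p.proj).right_inv hz] at this
    refine this.trans ?_
    exact congrArg _ (trivializationAt_extChartAt_tangentBundle_symm hz)
  exact congrArg (fun f ↦ f v) (h.trans heq.fderiv_eq)

lemma extChartAt_tangentBundle_apply_transition {p₀ p : TangentBundle I M}
    (hp : p.proj ∈ (extChartAt I p₀.proj).source) :
    extChartAt I.tangent p₀ p = (chartTransition I p₀.proj p.proj (extChartAt I p.proj p.proj),
      fderiv ℝ (chartTransition I p₀.proj p.proj) (extChartAt I p.proj p.proj) p.snd) := by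
  refine Prod.ext ?_ ?_
  · exact congrArg (extChartAt I p₀.proj) (extChartAt_to_inv (I := I) p.proj).symm
  · refine (trivializationAt_snd_transition hp (mem_extChartAt_source p.proj) p.snd).trans ?_
    exact congrArg _ (trivializationAt_snd_self p)

/-- Naturality of the complete lift. Readings in two charts satisfy $\xi_0\circ\tau=D\tau\cdot\xi$.
Differentiating along $w$ gives $D\xi_0(D\tau\,w)=D^2\tau(w,\xi)+D\tau(D\xi\,w)$, which by symmetry
of $D^2\tau$ is the second component of the derivative of $(\tau,D\tau)$ applied to $(\xi,D\xi\,w)$.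
-/
lemma mfderiv_extChartAt_completeLift {X : Π x : M, TangentSpace I x}
    (hX : ContMDiff I I.tangent 2 (fun y ↦ (⟨y, X y⟩ : TangentBundle I M)))
    {p₀ p : TangentBundle I M} (hp : p.proj ∈ (extChartAt I p₀.proj).source) :
    mfderiv I.tangent 𝓘(ℝ, E × E) (extChartAt I.tangent p₀) p (completeLift X p)
      = modelCompleteLift (chartReading p₀.proj X) (extChartAt I.tangent p₀ p) := by
  have hx := mem_extChartAt_source (I := I) p.proj
  have hnhds := (isOpen_extChartAt_target (I := I) p.proj).mem_nhds (mem_extChartAt_target p.proj)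
  rw [mfderiv_extChartAt_tangentBundle hp, completeLift_eq hX,
    extChartAt_tangentBundle_apply_transition hp]
  have hτ := contDiffAt_chartTransition (I := I) hp hx
  have hτ1 : DifferentiableAt ℝ (chartTransition I p₀.proj p.proj) (extChartAt I p.proj p.proj) :=
    hτ.differentiableAt (by norm_num)
  have hτ2 : DifferentiableAt ℝ (fderiv ℝ (chartTransition I p₀.proj p.proj))
      (extChartAt I p.proj p.proj) :=
    (hτ.fderiv_right (m := 1) (by norm_num)).differentiableAt (by norm_num)
  have hξ : DifferentiableAt ℝ (chartReading p.proj X) (extChartAt I p.proj p.proj) :=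
    ((contDiffOn_chartReading p.proj hX).contDiffAt hnhds).differentiableAt (by norm_num)
  have hξ₀ : DifferentiableAt ℝ (chartReading p₀.proj X)
      (chartTransition I p₀.proj p.proj (extChartAt I p.proj p.proj)) := by
    rw [chartTransition, extChartAt_to_inv (I := I)]
    exact ((contDiffOn_chartReading p₀.proj hX).contDiffAt
      ((isOpen_extChartAt_target (I := I) p₀.proj).mem_nhds
        ((extChartAt I p₀.proj).map_source hp))).differentiableAt (by norm_num)
  have heq : chartReading p₀.proj X ∘ chartTransition I p₀.proj p.proj
      =ᶠ[nhds (extChartAt I p.proj p.proj)] fun u ↦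
        fderiv ℝ (chartTransition I p₀.proj p.proj) u (chartReading p.proj X u) := by
    filter_upwards [hnhds, (continuousAt_extChartAt_symm (I := I) p.proj).eventually_mem
      ((isOpen_extChartAt_source (I := I) p₀.proj).mem_nhds (by simpa using hp))] with u hu hu'
    exact chartReading_chartTransition X hu hu'
  have h0 := heq.self_of_nhds
  -- The transformation rule holds near the point, so its two sides have equal derivatives there.
  have h1 := ((hξ₀.hasFDerivAt.comp _ hτ1.hasFDerivAt).congr_of_eventuallyEq heq.symm).unique
    (hτ2.hasFDerivAt.clm_apply hξ.hasFDerivAt)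
  have hself := chartReading_apply_self X p.proj
  -- From here on only calculus on `E` is left, so the manifold data are forgotten.
  generalize chartReading p.proj X = ξ at *
  generalize chartReading p₀.proj X = ξ₀ at *
  generalize chartTransition I p₀.proj p.proj = τ at *
  generalize extChartAt I p.proj p.proj = u at *
  have key : ∀ w a : E, ξ u = a → fderiv ℝ (modelCompleteLift τ) (u, w) (a, fderiv ℝ ξ u w)
      = modelCompleteLift ξ₀ (τ u, fderiv ℝ τ u w) := by
    rintro w a rfl
    have h1w := congrArg (fun f ↦ f w) h1
    simp only [ContinuousLinearMap.comp_apply, add_apply, ContinuousLinearMap.flip_apply] at h1w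
    rw [(hasFDerivAt_modelCompleteLift hτ).fderiv, modelCompleteLift, h1w]
    simp only [ContinuousLinearMap.prod_apply, ContinuousLinearMap.comp_apply, add_apply,
      ContinuousLinearMap.coe_fst', ContinuousLinearMap.coe_snd', ContinuousLinearMap.flip_apply,
      (hτ.isSymmSndFDerivAt (by simp)).eq w]
    exact Prod.ext h0.symm rfl
  exact key p.snd (X p.proj) hself

/-- In a vertical direction the derivative of $(\tau,D\tau)$ is just $D\tau$ on the fibre component,
so no second derivative enters and `X` needs no regularity. -/
lemma mfderiv_extChartAt_verticalLift (X : Π x : M, TangentSpace I x)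
    {p₀ p : TangentBundle I M} (hp : p.proj ∈ (extChartAt I p₀.proj).source) :
    mfderiv I.tangent 𝓘(ℝ, E × E) (extChartAt I.tangent p₀) p (verticalLift X p)
      = modelVerticalLift (chartReading p₀.proj X) (extChartAt I.tangent p₀ p) := by
  have hτ := contDiffAt_chartTransition (I := I) hp (mem_extChartAt_source (I := I) p.proj)
  have h0 := chartReading_chartTransition X (mem_extChartAt_target (I := I) p.proj)
    ((congrArg (· ∈ (extChartAt I p₀.proj).source) (extChartAt_to_inv (I := I) p.proj)).mpr hp)
  rw [mfderiv_extChartAt_tangentBundle hp, verticalLift_eq,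
    extChartAt_tangentBundle_apply_transition hp, modelVerticalLift, h0, chartReading_apply_self]
  have key : ∀ (w a : E) (τ : E → E) (u : E), ContDiffAt ℝ 2 τ u →
      fderiv ℝ (modelCompleteLift τ) (u, w) (0, a) = (0, fderiv ℝ τ u a) := by
    intro w a τ u hτ
    rw [(hasFDerivAt_modelCompleteLift hτ).fderiv]
    simp
  exact key _ _ _ _ hτ

end LiftsInCharts

/-! ### Differentiability and brackets from the expression in one chart. -/

section FieldsInCharts

open VectorField

variable {E : Type*} [NormedAddCommGroup E] [NormedSpace ℝ E] [CompleteSpace E]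
  {H : Type*} [TopologicalSpace H] {I : ModelWithCorners ℝ E H}
  {M : Type*} [TopologicalSpace M] [ChartedSpace H M] [IsManifold I ∞ M]
  {A B : Π x : M, TangentSpace I x} {F G : E → E} {x₀ : M}

omit [CompleteSpace E] in
lemma eventuallyEq_mpullback_extChartAt
    (hA : ∀ x ∈ (extChartAt I x₀).source,
      mfderiv I 𝓘(ℝ, E) (extChartAt I x₀) x (A x) = F (extChartAt I x₀ x)) :
    A =ᶠ[nhds x₀] mpullback I 𝓘(ℝ, E) (extChartAt I x₀) F := by
  filter_upwards [extChartAt_source_mem_nhds (I := I) x₀] with x hx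
  exact ((isInvertible_mfderiv_extChartAt hx).inverse_apply_eq.2 (hA x hx).symm).symm

lemma mdifferentiableAt_of_extChartAt
    (hA : ∀ x ∈ (extChartAt I x₀).source,
      mfderiv I 𝓘(ℝ, E) (extChartAt I x₀) x (A x) = F (extChartAt I x₀ x))
    (hF : ContDiffAt ℝ 1 F (extChartAt I x₀ x₀)) :
    MDifferentiableAt I I.tangent (fun x ↦ (⟨x, A x⟩ : TangentBundle I M)) x₀ := by
  have h1 : MDifferentiableAt 𝓘(ℝ, E) (𝓘(ℝ, E)).tangent
      (fun x ↦ (⟨x, F x⟩ : TangentBundle 𝓘(ℝ, E) E)) (extChartAt I x₀ x₀) :=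
    (contMDiffAt_vectorSpace_iff_contDiffAt.2 hF).mdifferentiableAt (by norm_num)
  have h2 := h1.mpullback_vectorField (n := 2) (I := I) (contMDiffAt_extChartAt (x := x₀))
    (isInvertible_mfderiv_extChartAt (mem_extChartAt_source x₀)) le_rfl
  refine h2.congr_of_eventuallyEq ?_
  filter_upwards [eventuallyEq_mpullback_extChartAt hA] with x hx
  rw [hx]

/-- Near `x₀` the fields are pullbacks of `F` and `G` by the chart, and brackets commute with
pullback. As the chart has invertible derivative, a candidate `v` can be tested on its image. -/
lemma mlieBracket_eq_of_extChartAt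
    (hA : ∀ x ∈ (extChartAt I x₀).source,
      mfderiv I 𝓘(ℝ, E) (extChartAt I x₀) x (A x) = F (extChartAt I x₀ x))
    (hF : ContDiffAt ℝ 1 F (extChartAt I x₀ x₀))
    (hB : ∀ x ∈ (extChartAt I x₀).source,
      mfderiv I 𝓘(ℝ, E) (extChartAt I x₀) x (B x) = G (extChartAt I x₀ x))
    (hG : ContDiffAt ℝ 1 G (extChartAt I x₀ x₀)) {v : TangentSpace I x₀}
    (hv : mfderiv I 𝓘(ℝ, E) (extChartAt I x₀) x₀ v = lieBracket ℝ F G (extChartAt I x₀ x₀)) :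
    mlieBracket I A B x₀ = v := by
  have : IsManifold I (minSmoothness ℝ 2) M := by
    rw [minSmoothness_of_isRCLikeNormedField]
    infer_instance
  have hmd : ∀ {F : E → E}, ContDiffAt ℝ 1 F (extChartAt I x₀ x₀) →
      MDifferentiableAt 𝓘(ℝ, E) (𝓘(ℝ, E)).tangent
        (fun x ↦ (⟨x, F x⟩ : TangentBundle 𝓘(ℝ, E) E)) (extChartAt I x₀ x₀) :=
    fun h ↦ (contMDiffAt_vectorSpace_iff_contDiffAt.2 h).mdifferentiableAt (by norm_num)
  rw [(eventuallyEq_mpullback_extChartAt hA).mlieBracket_vectorField_eq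
    (eventuallyEq_mpullback_extChartAt hB), ← mpullback_mlieBracket (n := 2) (hmd hF) (hmd hG)
    contMDiffAt_extChartAt (by rw [minSmoothness_of_isRCLikeNormedField])]
  refine (isInvertible_mfderiv_extChartAt (mem_extChartAt_source x₀)).inverse_apply_eq.2 ?_
  rw [hv]
  exact mlieBracket_eq_lieBracket F G _

end FieldsInCharts

/-! ### Brackets of complete and vertical lifts. -/

section LiftBrackets

open VectorField

variable {E : Type*} [NormedAddCommGroup E] [NormedSpace ℝ E]
  {H : Type*} [TopologicalSpace H] {I : ModelWithCorners ℝ E H} [I.Boundaryless]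
  {M : Type*} [TopologicalSpace M] [ChartedSpace H M] [IsManifold I ∞ M]
  {X Y : Π x : M, TangentSpace I x}

lemma contDiffAt_modelCompleteLift {ξ : E → E} {z : E × E} (hξ : ContDiffAt ℝ 2 ξ z.1) :
    ContDiffAt ℝ 1 (modelCompleteLift ξ) z :=
  ((hξ.of_le (by norm_num)).comp z contDiffAt_fst).prodMk
    (((hξ.fderiv_right (m := 1) (by norm_num)).comp z contDiffAt_fst).clm_apply contDiffAt_snd)

lemma contDiffAt_modelVerticalLift {ξ : E → E} {z : E × E} (hξ : ContDiffAt ℝ 2 ξ z.1) :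
    ContDiffAt ℝ 1 (modelVerticalLift ξ) z :=
  contDiffAt_const.prodMk ((hξ.of_le (by norm_num)).comp z contDiffAt_fst)

lemma contDiffAt_chartReading_tangentBundle
    (hX : ContMDiff I I.tangent 2 (fun y ↦ (⟨y, X y⟩ : TangentBundle I M)))
    (p : TangentBundle I M) :
    ContDiffAt ℝ 2 (chartReading p.proj X) (extChartAt I.tangent p p).1 :=
  (contDiffOn_chartReading p.proj hX).contDiffAt
    ((isOpen_extChartAt_target p.proj).mem_nhds (mem_extChartAt_target p.proj))

lemma mdifferentiableAt_completeLift [CompleteSpace E]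
    (hX : ContMDiff I I.tangent 2 (fun y ↦ (⟨y, X y⟩ : TangentBundle I M)))
    (p : TangentBundle I M) :
    MDifferentiableAt I.tangent I.tangent.tangent
      (fun q ↦ (⟨q, completeLift X q⟩ : TangentBundle I.tangent (TangentBundle I M))) p :=
  mdifferentiableAt_of_extChartAt
    (fun _ hq ↦ mfderiv_extChartAt_completeLift hX (mem_extChartAt_tangentBundle_source.1 hq))
    (contDiffAt_modelCompleteLift (contDiffAt_chartReading_tangentBundle hX p))

lemma mdifferentiableAt_verticalLift [CompleteSpace E]
    (hX : ContMDiff I I.tangent 2 (fun y ↦ (⟨y, X y⟩ : TangentBundle I M)))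
    (p : TangentBundle I M) :
    MDifferentiableAt I.tangent I.tangent.tangent
      (fun q ↦ (⟨q, verticalLift X q⟩ : TangentBundle I.tangent (TangentBundle I M))) p :=
  mdifferentiableAt_of_extChartAt
    (fun _ hq ↦ mfderiv_extChartAt_verticalLift X (mem_extChartAt_tangentBundle_source.1 hq))
    (contDiffAt_modelVerticalLift (contDiffAt_chartReading_tangentBundle hX p))

/-- `[X^v, Y^v] = 0`. -/
theorem mlieBracket_verticalLift [CompleteSpace E]
    (hX : ContMDiff I I.tangent 2 (fun y ↦ (⟨y, X y⟩ : TangentBundle I M)))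
    (hY : ContMDiff I I.tangent 2 (fun y ↦ (⟨y, Y y⟩ : TangentBundle I M)))
    (p : TangentBundle I M) :
    mlieBracket I.tangent (verticalLift X) (verticalLift Y) p = 0 := by
  have hξ := contDiffAt_chartReading_tangentBundle hX p
  have hη := contDiffAt_chartReading_tangentBundle hY p
  refine mlieBracket_eq_of_extChartAt
    (fun _ hq ↦ mfderiv_extChartAt_verticalLift X (mem_extChartAt_tangentBundle_source.1 hq))
    (contDiffAt_modelVerticalLift hξ)
    (fun _ hq ↦ mfderiv_extChartAt_verticalLift Y (mem_extChartAt_tangentBundle_source.1 hq))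
    (contDiffAt_modelVerticalLift hη) ?_
  rw [map_zero, lieBracket_modelVerticalLift (hξ.differentiableAt (by norm_num))
    (hη.differentiableAt (by norm_num))]
  rfl

/-- `[X^c, Y^v] = [X, Y]^v`. -/
theorem mlieBracket_completeLift_verticalLift [CompleteSpace E]
    (hX : ContMDiff I I.tangent 2 (fun y ↦ (⟨y, X y⟩ : TangentBundle I M)))
    (hY : ContMDiff I I.tangent 2 (fun y ↦ (⟨y, Y y⟩ : TangentBundle I M)))
    (p : TangentBundle I M) :
    mlieBracket I.tangent (completeLift X) (verticalLift Y) p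
      = verticalLift (mlieBracket I X Y) p := by
  have hξ := contDiffAt_chartReading_tangentBundle hX p
  have hη := contDiffAt_chartReading_tangentBundle hY p
  refine mlieBracket_eq_of_extChartAt
    (fun _ hq ↦ mfderiv_extChartAt_completeLift hX (mem_extChartAt_tangentBundle_source.1 hq))
    (contDiffAt_modelCompleteLift hξ)
    (fun _ hq ↦ mfderiv_extChartAt_verticalLift Y (mem_extChartAt_tangentBundle_source.1 hq))
    (contDiffAt_modelVerticalLift hη) ?_
  rw [mfderiv_extChartAt_verticalLift _ (mem_extChartAt_source p.proj),
    lieBracket_modelCompleteLift_modelVerticalLift hξ (hη.differentiableAt (by norm_num))]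
  exact Prod.ext rfl (chartReading_mlieBracket p.proj hX hY (mem_extChartAt_target p.proj))

/-- `[X^c, Y^c] = [X, Y]^c`. -/
theorem mlieBracket_completeLift [CompleteSpace E]
    (hX : ContMDiff I I.tangent 2 (fun y ↦ (⟨y, X y⟩ : TangentBundle I M)))
    (hY : ContMDiff I I.tangent 2 (fun y ↦ (⟨y, Y y⟩ : TangentBundle I M)))
    (hXY : ContMDiff I I.tangent 2 (fun y ↦ (⟨y, mlieBracket I X Y y⟩ : TangentBundle I M)))
    (p : TangentBundle I M) :
    mlieBracket I.tangent (completeLift X) (completeLift Y) p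
      = completeLift (mlieBracket I X Y) p := by
  have hξ := contDiffAt_chartReading_tangentBundle hX p
  have hη := contDiffAt_chartReading_tangentBundle hY p
  refine mlieBracket_eq_of_extChartAt
    (fun _ hq ↦ mfderiv_extChartAt_completeLift hX (mem_extChartAt_tangentBundle_source.1 hq))
    (contDiffAt_modelCompleteLift hξ)
    (fun _ hq ↦ mfderiv_extChartAt_completeLift hY (mem_extChartAt_tangentBundle_source.1 hq))
    (contDiffAt_modelCompleteLift hη) ?_
  -- A bracket of $C^2$ fields need only be $C^1$, hence the separate hypothesis `hXY`.
  rw [mfderiv_extChartAt_completeLift hXY (mem_extChartAt_source p.proj),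
    lieBracket_modelCompleteLift hξ hη]
  -- The complete lift differentiates the reading, so equality at the point alone would not suffice.
  have heq := (chartReading_mlieBracket p.proj hX hY).eventuallyEq_of_mem
    ((isOpen_extChartAt_target p.proj).mem_nhds (mem_extChartAt_target p.proj))
  exact Prod.ext heq.self_of_nhds
    (congrArg (fun f : E →L[ℝ] E ↦ f (extChartAt I.tangent p p).2) heq.fderiv_eq)

end LiftBrackets

/-! ### Lifts of left invariant vector fields. -/

section InvariantFields

open VectorField

variable {E : Type*} [NormedAddCommGroup E] [NormedSpace ℝ E]
  {H : Type*} [TopologicalSpace H] {I : ModelWithCorners ℝ E H}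
  {G : Type*} [TopologicalSpace G] [ChartedSpace H G] [Group G]

lemma mulInvariantVectorField_sum_smul {ι : Type*} (s : Finset ι) (r : ι → ℝ)
    (v : ι → GroupLieAlgebra I G) (g : G) :
    mulInvariantVectorField (∑ k ∈ s, r k • v k) g
      = ∑ k ∈ s, r k • mulInvariantVectorField (v k) g := by
  simp [mulInvariantVectorField]
  rfl

variable [LieGroup I ∞ G]

lemma contMDiff_two_mulInvariantVectorField (v : GroupLieAlgebra I G) :
    ContMDiff I I.tangent 2 (fun g ↦ (⟨g, mulInvariantVectorField v g⟩ : TangentBundle I G)) := by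
  have : LieGroup I (minSmoothness ℝ 3) G := by
    rw [minSmoothness_of_isRCLikeNormedField]
    exact LieGroup.of_le (n := ∞) (WithTop.coe_le_coe.2 le_top)
  simpa using contMDiff_mulInvariantVectorField v

lemma mlieBracket_mulInvariantVectorField [CompleteSpace E] (v w : GroupLieAlgebra I G) :
    mlieBracket I (mulInvariantVectorField v) (mulInvariantVectorField w)
      = mulInvariantVectorField (⁅v, w⁆ : GroupLieAlgebra I G) := by
  have : LieGroup I (minSmoothness ℝ 3) G := by
    rw [minSmoothness_of_isRCLikeNormedField]
    exact LieGroup.of_le (n := ∞) (WithTop.coe_le_coe.2 le_top)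
  exact (mulInvariantVector_mlieBracket v w).symm

lemma IsLeftInvariantMetric.inner_mulInvariantVectorField {g : SmoothRiemannianMetric I G}
    (hg : IsLeftInvariantMetric g) (v w : GroupLieAlgebra I G) (a : G) :
    g.inner a (mulInvariantVectorField v a) (mulInvariantVectorField w a) = g.inner 1 v w := by
  -- Invariance lands at `a * 1`; a free base point `b` allows substitution despite the dependent
  -- tangent spaces.
  have h : ∀ b, a * 1 = b → g.inner b (mfderiv I I (a * ·) 1 v : E) (mfderiv I I (a * ·) 1 w : E)
      = g.inner 1 v w := by
    rintro _ rfl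
    exact hg a 1 v w
  exact h a (mul_one a)

lemma liftV_sum_smul {ι : Type*} (s : Finset ι) (r : ι → ℝ)
    (v : ι → GroupLieAlgebra I G) (p : TangentBundle I G) :
    liftV (∑ k ∈ s, r k • v k) p = ∑ k ∈ s, r k • liftV (v k) p := by
  simp only [liftV, verticalLift_eq]
  rw [mulInvariantVectorField_sum_smul]
  have : ∀ a : ι → E, ((0, ∑ k ∈ s, r k • a k) : E × E) = ∑ k ∈ s, r k • ((0, a k) : E × E) := by
    intro a
    ext <;> simp [Prod.fst_sum, Prod.snd_sum]
  exact this _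

/-- Constancy of the coefficients is essential: for a function $f$, $(fX)^c$ would acquire a
vertical term containing $df$. -/
lemma liftC_sum_smul [I.Boundaryless] {ι : Type*} (s : Finset ι) (r : ι → ℝ)
    (v : ι → GroupLieAlgebra I G) (p : TangentBundle I G) :
    liftC (∑ k ∈ s, r k • v k) p = ∑ k ∈ s, r k • liftC (v k) p := by
  have hread : chartReading p.proj (mulInvariantVectorField (∑ k ∈ s, r k • v k))
      = fun u ↦ ∑ k ∈ s, r k • chartReading p.proj (mulInvariantVectorField (v k)) u := by
    funext u
    simp only [chartReading]
    rw [mulInvariantVectorField_sum_smul]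
    generalize (extChartAt I p.proj).symm u = y
    refine (map_sum (tangentCoordChange I y p.proj y) (fun k ↦ r k • mulInvariantVectorField (v k) y)
      s).trans (Finset.sum_congr rfl fun k _ ↦ map_smul _ _ _)
  have hdiff : ∀ k, DifferentiableAt ℝ (chartReading p.proj (mulInvariantVectorField (v k)))
      (extChartAt I p.proj p.proj) := fun k ↦
    (contDiffAt_chartReading_tangentBundle
      (contMDiff_two_mulInvariantVectorField (v k)) p).differentiableAt (by norm_num)
  have hfd : fderiv ℝ (chartReading p.proj (mulInvariantVectorField (∑ k ∈ s, r k • v k)))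
      (extChartAt I p.proj p.proj) = ∑ k ∈ s, r k • fderiv ℝ
        (chartReading p.proj (mulInvariantVectorField (v k))) (extChartAt I p.proj p.proj) := by
    rw [hread]
    exact (HasFDerivAt.fun_sum fun k _ ↦ (hdiff k).hasFDerivAt.const_smul (r k)).fderiv
  simp only [liftC, completeLift_eq (contMDiff_two_mulInvariantVectorField _)]
  rw [mulInvariantVectorField_sum_smul, hfd]
  have : ∀ (a : ι → E) (L : ι → E →L[ℝ] E) (w : E),
      ((∑ k ∈ s, r k • a k, (∑ k ∈ s, r k • L k) w) : E × E)
        = ∑ k ∈ s, r k • ((a k, L k w) : E × E) := by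
    intro a L w
    ext <;> simp [Prod.fst_sum, Prod.snd_sum]
  exact this _ _ _

variable [I.Boundaryless] [CompleteSpace E]

lemma mlieBracket_liftC (v w : GroupLieAlgebra I G) (p : TangentBundle I G) :
    mlieBracket I.tangent (liftC v) (liftC w) p = liftC (⁅v, w⁆ : GroupLieAlgebra I G) p := by
  have h := mlieBracket_completeLift (contMDiff_two_mulInvariantVectorField v)
    (contMDiff_two_mulInvariantVectorField w)
    (by rw [mlieBracket_mulInvariantVectorField]; exact contMDiff_two_mulInvariantVectorField _) p
  rw [mlieBracket_mulInvariantVectorField] at h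
  exact h

lemma mlieBracket_liftC_liftV (v w : GroupLieAlgebra I G) (p : TangentBundle I G) :
    mlieBracket I.tangent (liftC v) (liftV w) p = liftV (⁅v, w⁆ : GroupLieAlgebra I G) p := by
  have h := mlieBracket_completeLift_verticalLift (contMDiff_two_mulInvariantVectorField v)
    (contMDiff_two_mulInvariantVectorField w) p
  rw [mlieBracket_mulInvariantVectorField] at h
  exact h

lemma mlieBracket_liftV (v w : GroupLieAlgebra I G) (p : TangentBundle I G) :
    mlieBracket I.tangent (liftV v) (liftV w) p = 0 :=
  mlieBracket_verticalLift (contMDiff_two_mulInvariantVectorField v)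
    (contMDiff_two_mulInvariantVectorField w) p

lemma mdifferentiableAt_liftC (v : GroupLieAlgebra I G) (p : TangentBundle I G) :
    MDifferentiableAt I.tangent I.tangent.tangent
      (fun q ↦ (⟨q, liftC v q⟩ : TangentBundle I.tangent (TangentBundle I G))) p :=
  mdifferentiableAt_completeLift (contMDiff_two_mulInvariantVectorField v) p

lemma mdifferentiableAt_liftV (v : GroupLieAlgebra I G) (p : TangentBundle I G) :
    MDifferentiableAt I.tangent I.tangent.tangent
      (fun q ↦ (⟨q, liftV v q⟩ : TangentBundle I.tangent (TangentBundle I G))) p :=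
  mdifferentiableAt_verticalLift (contMDiff_two_mulInvariantVectorField v) p

end InvariantFields

/-! ### The orthonormal frames of $G$ and $TG$, and the three curvatures. -/

section Frames

open VectorField

variable {E : Type*} [NormedAddCommGroup E] [NormedSpace ℝ E] [FiniteDimensional ℝ E]
  {H : Type*} [TopologicalSpace H] {I : ModelWithCorners ℝ E H} [I.Boundaryless]
  {G : Type*} [TopologicalSpace G] [ChartedSpace H G] [Group G] [LieGroup I ∞ G]
  {g₁ g₂ : SmoothRiemannianMetric I G} {n : ℕ}
  {X : Module.Basis (Fin n) ℝ (GroupLieAlgebra I G)} {lam : Fin n → ℝ}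
  {c : Fin n → Fin n → Fin n → ℝ}

omit [FiniteDimensional ℝ E] [I.Boundaryless] [LieGroup I ∞ G] in
lemma card_basis_groupLieAlgebra (X : Module.Basis (Fin n) ℝ (GroupLieAlgebra I G)) :
    n = Module.finrank ℝ E := by
  have h := Module.finrank_eq_card_basis X
  rw [Fintype.card_fin] at h
  exact h.symm

omit [I.Boundaryless] in
lemma isOrthonormalFrame_mulInvariantVectorField (hg₁ : IsLeftInvariantMetric g₁)
    (hX : ∀ i j, g₁.inner 1 (X i) (X j) = if i = j then 1 else 0)
    (hc : ∀ i j, ⁅X i, X j⁆ = ∑ k, c i j k • X k) :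
    IsOrthonormalFrame g₁ (fun i ↦ mulInvariantVectorField (X i)) c where
  mdifferentiableAt i x :=
    (contMDiff_two_mulInvariantVectorField (X i)).mdifferentiable (by norm_num) x
  inner_eq i j x := by rw [hg₁.inner_mulInvariantVectorField, hX]
  bracket i j x := by
    have : CompleteSpace E := FiniteDimensional.complete ℝ E
    rw [mlieBracket_mulInvariantVectorField, hc, mulInvariantVectorField_sum_smul]
  card_eq := by rw [Fintype.card_fin, card_basis_groupLieAlgebra X]

/-- The frame `X_i^c`, `X_i^v / √λ_i` of the tangent Lie group. -/
noncomputable def liftFrame (X : Fin n → GroupLieAlgebra I G) (lam : Fin n → ℝ) :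
    Fin n ⊕ Fin n → Π p : TangentBundle I G, TangentSpace I.tangent p
  | .inl i => liftC (X i)
  | .inr i => fun q ↦ (1 / √(lam i)) • liftV (X i) q

/-- The structure constants of the frame `X_i^c`, `X_i^v / √λ_i`. -/
noncomputable def liftStructureConstant (c : Fin n → Fin n → Fin n → ℝ) (lam : Fin n → ℝ) :
    Fin n ⊕ Fin n → Fin n ⊕ Fin n → Fin n ⊕ Fin n → ℝ
  | .inl i, .inl j, .inl k => c i j k
  | .inl i, .inr j, .inr k => c i j k * √(lam k) / √(lam j)
  | .inr i, .inl j, .inr k => -(c j i k * √(lam k) / √(lam i))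
  | _, _, _ => 0

-- $\lambda_i=g^2(X_i,X_i)$.
omit [FiniteDimensional ℝ E] [I.Boundaryless] in
lemma eigenvalue_pos {φ : GroupLieAlgebra I G →ₗ[ℝ] GroupLieAlgebra I G}
    (hφ : ∀ X Y : GroupLieAlgebra I G, g₂.inner 1 X Y = g₁.inner 1 (φ X) Y)
    (hX : ∀ i j, g₁.inner 1 (X i) (X j) = if i = j then 1 else 0)
    (hlam : ∀ i, φ (X i) = lam i • X i) (i : Fin n) : 0 < lam i := by
  have h := g₂.pos 1 (X i) (X.ne_zero i)
  rw [hφ, hlam, map_smul, smul_apply, hX] at h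
  simpa using h

lemma isOrthonormalFrame_liftFrame
    {gt : SmoothRiemannianMetric I.tangent (TangentBundle I G)} (hgt : IsLiftedMetric g₁ g₂ gt)
    (hlam : ∀ i, 0 < lam i)
    (hX₁ : ∀ i j, g₁.inner 1 (X i) (X j) = if i = j then 1 else 0)
    (hX₂ : ∀ i j, g₂.inner 1 (X i) (X j) = if i = j then lam i else 0)
    (hc : ∀ i j, ⁅X i, X j⁆ = ∑ k, c i j k • X k) :
    IsOrthonormalFrame gt (liftFrame X lam) (liftStructureConstant c lam) := by
  have : CompleteSpace E := FiniteDimensional.complete ℝ E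
  have hs : ∀ i, √(lam i) ≠ 0 := fun i ↦ (Real.sqrt_pos.2 (hlam i)).ne'
  -- The ratio $\sqrt{\lambda_k}/\sqrt{\lambda_j}$ comes from normalizing the vertical field in the
  -- bracket and those in its expansion.
  have hCV : ∀ i j p, mlieBracket I.tangent (liftC (X i))
      (fun q ↦ (1 / √(lam j)) • liftV (X j) q) p
      = ∑ k, (c i j k * √(lam k) / √(lam j)) • (1 / √(lam k)) • liftV (X k) p := by
    intro i j p
    refine (mlieBracket_const_smul_right (c := 1 / √(lam j))
      (mdifferentiableAt_liftV (X j) p)).trans ?_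
    rw [mlieBracket_liftC_liftV, hc, liftV_sum_smul, Finset.smul_sum]
    refine Finset.sum_congr rfl fun k _ ↦ ?_
    rw [smul_smul, smul_smul]
    congr 1
    have := hs k
    field_simp
  refine ⟨?_, ?_, ?_, ?_⟩
  · rintro (i | i) p
    · exact mdifferentiableAt_liftC (X i) p
    · exact (mdifferentiableAt_liftV (X i) p).smul_const_section
  · rintro (i | i) (j | j) p
    · simpa [liftFrame, liftC] using (hgt.complete_complete (X i) (X j) p).trans (hX₁ i j)
    · have h := hgt.complete_vertical (X i) (X j) p
      simpa [liftFrame, liftC, liftV] using Or.inr h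
    · have h := hgt.complete_vertical (X j) (X i) p
      rw [gt.symm] at h
      simpa [liftFrame, liftC, liftV] using Or.inr h
    · have h := (hgt.vertical_vertical (X i) (X j) p).trans (hX₂ i j)
      change gt.inner p ((1 / √(lam i)) • liftV (X i) p) ((1 / √(lam j)) • liftV (X j) p) = _
      simp only [map_smul, smul_apply, smul_eq_mul]
      rw [show gt.inner p (liftV (X i) p) (liftV (X j) p) = _ from h]
      by_cases hij : i = j
      · subst hij
        have := hs i
        simp only [if_true]
        field_simp
        exact (Real.sq_sqrt (hlam i).le).symm
      · simp [hij]
  · rintro (i | i) (j | j) p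
    · rw [Fintype.sum_sum_type]
      simp [liftFrame, liftStructureConstant, mlieBracket_liftC, hc, liftC_sum_smul]
    · rw [Fintype.sum_sum_type]
      simpa [liftFrame, liftStructureConstant] using hCV i j p
    · rw [mlieBracket_swap_apply, Fintype.sum_sum_type]
      simpa [liftFrame, liftStructureConstant] using hCV j i p
    · rw [Fintype.sum_sum_type]
      have h : mlieBracket I.tangent (fun q ↦ (1 / √(lam i)) • liftV (X i) q)
          (fun q ↦ (1 / √(lam j)) • liftV (X j) q) p = 0 := by
        refine (mlieBracket_const_smul_right (c := 1 / √(lam j))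
          (mdifferentiableAt_liftV (X j) p)).trans ?_
        rw [show mlieBracket I.tangent (fun q ↦ (1 / √(lam i)) • liftV (X i) q) (liftV (X j)) p = _
          from mlieBracket_const_smul_left (c := 1 / √(lam i)) (mdifferentiableAt_liftV (X i) p),
          mlieBracket_liftV]
        simp
      simpa [liftFrame, liftStructureConstant] using h
  · have h := card_basis_groupLieAlgebra X
    simp [← h]

-- In Milnor's sum every term with a vertical summation index vanishes; the complete indices carry
-- the structure constants of $G$ unchanged.
omit [I.Boundaryless] in
lemma IsOrthonormalFrame.sectionalCurvature_liftC
    {gt : SmoothRiemannianMetric I.tangent (TangentBundle I G)}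
    {Dt : AffineConnection I.tangent (TangentBundle I G)} (hDt : IsLeviCivita gt Dt)
    (h : IsOrthonormalFrame gt (liftFrame X lam) (liftStructureConstant c lam))
    (hanti : ∀ i j k, c i j k = -c j i k) {i j : Fin n} (hij : i ≠ j) (p : TangentBundle I G) :
    sectionalCurvature gt Dt (liftC (X i)) (liftC (X j)) p
      = (1 / 4) * ∑ l, (- 4 * c l j j * c l i i
          - (c i j l - c j l i + c l i j) * (c j l i - c l i j + c i j l)
          - 2 * c i j l * (c l j i - c j i l + c i l j)) := by
  have hne : (Sum.inl i : Fin n ⊕ Fin n) ≠ Sum.inl j := by simpa using hij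
  refine (h.sectionalCurvature_eq hDt hne p).trans ?_
  rw [Fintype.sum_sum_type, Finset.mul_sum]
  simp only [liftStructureConstant]
  rw [← Finset.sum_add_distrib]
  refine Finset.sum_congr rfl fun l _ ↦ ?_
  rw [hanti l j i, hanti j i l, hanti i l j]
  ring

-- Here only complete summation indices contribute: $[X_i^v,X_j^v]=0$ removes `α a b k`, and the
-- remaining mixed constants combine into a square.
omit [I.Boundaryless] in
lemma IsOrthonormalFrame.sectionalCurvature_liftV
    {gt : SmoothRiemannianMetric I.tangent (TangentBundle I G)}
    {Dt : AffineConnection I.tangent (TangentBundle I G)} (hDt : IsLeviCivita gt Dt)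
    (h : IsOrthonormalFrame gt (liftFrame X lam) (liftStructureConstant c lam))
    (hlam : ∀ i, 0 < lam i) {i j : Fin n} (hij : i ≠ j) (p : TangentBundle I G) :
    sectionalCurvature gt Dt (fun q ↦ (1 / √(lam i)) • liftV (X i) q)
        (fun q ↦ (1 / √(lam j)) • liftV (X j) q) p
      = (1 / 4) * ∑ l, ((√(lam j) / √(lam i) * c l i j + √(lam i) / √(lam j) * c l j i) ^ 2
          - 4 * c l j j * c l i i) := by
  have hne : (Sum.inr i : Fin n ⊕ Fin n) ≠ Sum.inr j := by simpa using hij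
  have hs : ∀ i, √(lam i) ≠ 0 := fun i ↦ (Real.sqrt_pos.2 (hlam i)).ne'
  refine (h.sectionalCurvature_eq hDt hne p).trans ?_
  rw [Fintype.sum_sum_type, Finset.mul_sum]
  simp only [liftStructureConstant]
  rw [← Finset.sum_add_distrib]
  refine Finset.sum_congr rfl fun l _ ↦ ?_
  have hi := hs i
  have hj := hs j
  field_simp
  ring

-- Vertical summation indices give the terms quadratic in mixed constants, complete ones give
-- $c_{lj}^jc_{li}^i$. The case `i = j` is allowed, since $X_i^v$ and $X_i^c$ are distinct frame
-- fields.
omit [I.Boundaryless] in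
lemma IsOrthonormalFrame.sectionalCurvature_liftV_liftC
    {gt : SmoothRiemannianMetric I.tangent (TangentBundle I G)}
    {Dt : AffineConnection I.tangent (TangentBundle I G)} (hDt : IsLeviCivita gt Dt)
    (h : IsOrthonormalFrame gt (liftFrame X lam) (liftStructureConstant c lam))
    (hlam : ∀ i, 0 < lam i) (hanti : ∀ i j k, c i j k = -c j i k) (i j : Fin n)
    (p : TangentBundle I G) :
    sectionalCurvature gt Dt (fun q ↦ (1 / √(lam i)) • liftV (X i) q) (liftC (X j)) p
      = (1 / 4) * ∑ l, (lam i / lam l * c j l i ^ 2 - 3 * (lam l / lam i) * c i j l ^ 2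
          - 2 * c i j l * c l j i - 4 * c l j j * c l i i) := by
  have hne : (Sum.inr i : Fin n ⊕ Fin n) ≠ Sum.inl j := Sum.inr_ne_inl
  have hs : ∀ i, √(lam i) ≠ 0 := fun i ↦ (Real.sqrt_pos.2 (hlam i)).ne'
  refine (h.sectionalCurvature_eq hDt hne p).trans ?_
  rw [Fintype.sum_sum_type, Finset.mul_sum]
  simp only [liftStructureConstant]
  rw [← Finset.sum_add_distrib]
  refine Finset.sum_congr rfl fun l _ ↦ ?_
  have hi := hs i
  have hl := hs l
  -- Everything is expressed through square roots for `field_simp`; `Real.sqrt_sq` repairs the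
  -- radicands, which the first rewrites also change.
  rw [← Real.sq_sqrt (hlam i).le, ← Real.sq_sqrt (hlam l).le, Real.sqrt_sq (Real.sqrt_nonneg _),
    Real.sqrt_sq (Real.sqrt_nonneg _), hanti j i l, hanti l j i]
  field_simp
  ring

end Frames

theorem theorem4p3
    {E : Type*} [NormedAddCommGroup E] [NormedSpace ℝ E] [FiniteDimensional ℝ E]
    {H : Type*} [TopologicalSpace H] {I : ModelWithCorners ℝ E H} [I.Boundaryless]
    {G : Type*} [TopologicalSpace G] [ChartedSpace H G] [Group G] [LieGroup I ∞ G]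
    -- two left invariant Riemannian metrics on `G`, and their lift to `TG`
    (g₁ g₂ : SmoothRiemannianMetric I G)
    (hg₁ : IsLeftInvariantMetric g₁) (hg₂ : IsLeftInvariantMetric g₂)
    (gt : SmoothRiemannianMetric I.tangent (TangentBundle I G))
    (hgt : IsLiftedMetric g₁ g₂ gt)
    -- the Levi-Civita connections of `(G, g₁)` and `(TG, gt)`
    (D₁ : AffineConnection I G) (hD₁ : IsLeviCivita g₁ D₁)
    (Dt : AffineConnection I.tangent (TangentBundle I G)) (hDt : IsLeviCivita gt Dt)
    -- `φ` with `⟨X, Y⟩₂ = ⟨φ X, Y⟩₁`, a `g₁`-orthonormal basis of eigenvectors of `φ`, and the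
    -- eigenvalues
    (φ : GroupLieAlgebra I G →ₗ[ℝ] GroupLieAlgebra I G)
    (hφ : ∀ X Y : GroupLieAlgebra I G, g₂.inner 1 X Y = g₁.inner 1 (φ X) Y)
    {n : ℕ} (X : Module.Basis (Fin n) ℝ (GroupLieAlgebra I G))
    (hX : ∀ i j, g₁.inner 1 (X i) (X j) = if i = j then 1 else 0)
    (lam : Fin n → ℝ) (hlam : ∀ i, φ (X i) = lam i • X i)
    -- the structure constants `c i j k = c_{ij}^k`
    (c : Fin n → Fin n → Fin n → ℝ) (hc : ∀ i j, ⁅X i, X j⁆ = ∑ k, c i j k • X k) :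
    (∀ i j, i ≠ j → ∀ p : TangentBundle I G,
      sectionalCurvature gt Dt (liftC (X i)) (liftC (X j)) p
          = (1 / 4) * ∑ l, (- 4 * c l j j * c l i i
              - (c i j l - c j l i + c l i j) * (c j l i - c l i j + c i j l)
              - 2 * c i j l * (c l j i - c j i l + c i l j)) ∧
      sectionalCurvature gt Dt (liftC (X i)) (liftC (X j)) p
          = sectionalCurvature g₁ D₁ (mulInvariantVectorField (X i))
              (mulInvariantVectorField (X j)) p.proj) ∧
    (∀ i j, i ≠ j → ∀ p : TangentBundle I G,
      sectionalCurvature gt Dt (fun q ↦ (1 / √(lam i)) • liftV (X i) q)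
          (fun q ↦ (1 / √(lam j)) • liftV (X j) q) p
        = (1 / 4) * ∑ l, ((√(lam j) / √(lam i) * c l i j + √(lam i) / √(lam j) * c l j i) ^ 2
            - 4 * c l j j * c l i i)) ∧
    (∀ i j, ∀ p : TangentBundle I G,
      sectionalCurvature gt Dt (fun q ↦ (1 / √(lam i)) • liftV (X i) q) (liftC (X j)) p
        = (1 / 4) * ∑ l, (lam i / lam l * c j l i ^ 2 - 3 * (lam l / lam i) * c i j l ^ 2
            - 2 * c i j l * c l j i - 4 * c l j j * c l i i)) := by
  have hpos := eigenvalue_pos hφ hX hlam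
  have hX₂ : ∀ i j, g₂.inner 1 (X i) (X j) = if i = j then lam i else 0 := by
    intro i j
    rw [hφ, hlam, map_smul, smul_apply, hX]
    simp
  have h₁ := isOrthonormalFrame_mulInvariantVectorField hg₁ hX hc
  have hanti := h₁.structureConstant_antisymm 1
  have ht := isOrthonormalFrame_liftFrame hgt hpos hX hX₂ hc
  refine ⟨fun i j hij p ↦ ?_, fun i j hij p ↦ ht.sectionalCurvature_liftV hDt hpos hij p,
    fun i j p ↦ ht.sectionalCurvature_liftV_liftC hDt hpos hanti i j p⟩
  have hK := ht.sectionalCurvature_liftC hDt hanti hij p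
  refine ⟨hK, hK.trans ?_⟩
  -- Milnor's formula for the frame of $G$ gives the same sum, independently of the base point.
  rw [h₁.sectionalCurvature_eq hD₁ hij p.proj, Finset.mul_sum]
  refine Finset.sum_congr rfl fun l _ ↦ ?_
  rw [hanti l j i, hanti j i l, hanti i l j]
  ring
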